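/- Let $\mathbf{X}=(X_1,\dots,X_n)$ be a finite sample of points of $\mathbb{R}^D$ (Euclidean norm). For $A\subset\mathbb{R}^D$ write $\mu_n(A)=\frac1n\#\{i: X_i\in A\}$ and let $\Delta_n(A)=\max\{\|x-x'\| : x,x'\in A\cap\mathbf{X}\}$ (and $\Delta_n(A)=0$ if $A\cap\mathbf{X}=\emptyset$). For a finite collection $\mathbf{A}$ of disjoint cells let $\Delta_n(\mathbf{A})=\Big(\frac{\sum_{A\in\mathbf{A}}\mu_n(A)\Delta_n(A)^2}{\sum_{A\in\mathbf{A}}\mu_n(A)}\Big)^{1/2}$ (and $0$ if no cell contains a sample point). The Assouad dimension of $S\subset\mathbb{R}^D$ is the smallest real $d\ge 0$ such that for every ball $B\subset\mathbb{R}^D$ the set $B\cap S$ can be covered by at most $2^d$ balls of half the radius of $B$. The procedure $\mathtt{basicRPtree}(A_0,\Delta,l)$ starts with $\mathbf{A}_0=\{A_0\}$ and in round $i=1,2,\dots$ does the following. If $\Delta_n(\mathbf{A}_{i-1})\le\Delta$, it returns the current tree. Otherwise it draws, independently of everything before, $v\sim\mathcal{N}(0,\frac1D I_D)$ and, independently of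 $v$, $\tau$ uniform on $[-1,1]\cdot\frac{6}{\sqrt D}\Delta_n(A_0)$, and bisects every cell $A\in\mathbf{A}_{i-1}$ into $\{x\in A: x^\top v\le t\}$ and its complement in $A$, where $t=\mathrm{median}\{z^\top v: z\in\mathbf{X}\cap A_0\}+\tau$ if $l+i$ is odd, and $t=\mathrm{median}\{z^\top v: z\in\mathbf{X}\cap A\}$ if $l+i$ is even; the resulting cells form $\mathbf{A}_i$. Theorem. There is an absolute constant $C'>0$ such that for all $D$, $n$, every sample $\mathbf{X}$ of $n$ points of $\mathbb{R}^D$, every $A\subset\mathbb{R}^D$, every level $l\ge 0$ and every $d$: if $A\cap\mathbf{X}$ has Assouad dimension $d$, then with probability at least $\frac12$ over the random draws of the procedure, the call $\mathtt{basicRPtree}(A,\Delta_n(A)/2,l)$ returns a tree, rooted at $A$, of depth at most $C'\,d\,\log\max\{d,2\}$ (that is, at most $C'd\log d$ whenever $d\ge 2$). -/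

import Mathlib

open MeasureTheory ProbabilityTheory
open scoped ENNReal

namespace RPTree

noncomputable section

open scoped Classical in
/-- The median of a finite multiset of reals: the middle entry of the sorted list, or the mean of
the two middle entries when the number of entries is even (and `0` for the empty multiset). -/
def median (s : Multiset ℝ) : ℝ :=
  ((s.sort (· ≤ ·)).getD ((s.card - 1) / 2) 0 + (s.sort (· ≤ ·)).getD (s.card / 2) 0) / 2

/-- `S` has Assouad (doubling) dimension `d`: `d` is the smallest nonnegative real number such that
for every ball `B`, the set `B ∩ S` can be covered by at most `2 ^ d` balls of half the radius
of `B`. The centres of all the balls are arbitrary points of the ambient space. -/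
def HasAssouadDim {D : ℕ} (S : Set (EuclideanSpace ℝ (Fin D))) (d : ℝ) : Prop :=
  IsLeast {e : ℝ | 0 ≤ e ∧ ∀ (x : EuclideanSpace ℝ (Fin D)) (r : ℝ), 0 < r →
    ∃ T : Finset (EuclideanSpace ℝ (Fin D)), (T.card : ℝ) ≤ (2 : ℝ) ^ e ∧
      Metric.closedBall x r ∩ S ⊆ ⋃ c ∈ T, Metric.closedBall c (r / 2)} d

/-- The data diameter `Δ_n(A)`: the largest distance between two sample points in `A`, and `0` if
`A` contains no sample point. -/
def dataDiam {D n : ℕ} (X : Fin n → EuclideanSpace ℝ (Fin D))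
    (A : Set (EuclideanSpace ℝ (Fin D))) : ℝ :=
  Metric.diam (A ∩ Set.range X)

open scoped Classical in
/-- The empirical mass `μ_n(A)`: the fraction of the sample that lies in `A`. -/
def empMass {D n : ℕ} (X : Fin n → EuclideanSpace ℝ (Fin D))
    (A : Set (EuclideanSpace ℝ (Fin D))) : ℝ :=
  ((Finset.univ.filter fun i => X i ∈ A).card : ℝ) / n

/-- The average data diameter of a list of disjoint cells `A`:
`(∑ μ_n(A) Δ_n(A)² / ∑ μ_n(A)) ^ (1/2)`. It is `0` if no cell contains a sample point. -/
def avgDataDiam {D n : ℕ} (X : Fin n → EuclideanSpace ℝ (Fin D))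
    (P : List (Set (EuclideanSpace ℝ (Fin D)))) : ℝ :=
  Real.sqrt ((P.map fun A => empMass X A * dataDiam X A ^ 2).sum / (P.map (empMass X)).sum)

open scoped Classical in
/-- The median of the projections `zᵀ v` of the sample points `z` that lie in `A`. -/
def projMedian {D n : ℕ} (X : Fin n → EuclideanSpace ℝ (Fin D))
    (A : Set (EuclideanSpace ℝ (Fin D))) (v : EuclideanSpace ℝ (Fin D)) : ℝ :=
  median ((Finset.univ.filter fun i => X i ∈ A).val.map fun i => inner ℝ (X i) v)

/-- Binary trees whose nodes carry cells (subsets of `ℝ^D`). -/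
inductive Tree (D : ℕ) : Type
  | leaf (cell : Set (EuclideanSpace ℝ (Fin D))) : Tree D
  | node (cell : Set (EuclideanSpace ℝ (Fin D))) (left right : Tree D) : Tree D

/-- The list of the cells at the leaves. -/
def Tree.leaves {D : ℕ} : Tree D → List (Set (EuclideanSpace ℝ (Fin D)))
  | .leaf A => [A]
  | .node _ L R => L.leaves ++ R.leaves

/-- The depth of a tree; the root is at level `0`. -/
def Tree.depth {D : ℕ} : Tree D → ℕ
  | .leaf _ => 0
  | .node _ L R => max L.depth R.depth + 1

/-- Bisect every leaf cell `A` by the hyperplane `xᵀ v = t A` into `{x ∈ A | xᵀ v ≤ t A}` and the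
rest of `A`. -/
def Tree.splitLeaves {D : ℕ} (v : EuclideanSpace ℝ (Fin D))
    (t : Set (EuclideanSpace ℝ (Fin D)) → ℝ) : Tree D → Tree D
  | .leaf A =>
      .node A (.leaf {x ∈ A | inner ℝ x v ≤ t A}) (.leaf (A \ {x ∈ A | inner ℝ x v ≤ t A}))
  | .node A L R => .node A (L.splitLeaves v t) (R.splitLeaves v t)

open scoped Classical in
/-- The threshold at which the cell `A` is split in round `i` (`i = 1, 2, …`) of the procedure with
root cell `A₀`, called at level `l`, when the direction drawn is `v` and the noise drawn is
`τ = u * (6 / √D) * Δ_n(A₀)`, with `u` in `[-1, 1]`. If `l + i` is odd it is the median of the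
projected sample points of the root cell plus `τ` (noisy split, the same hyperplane for every cell),
otherwise it is the median of the projected sample points of `A` (median split). -/
def threshold {D n : ℕ} (X : Fin n → EuclideanSpace ℝ (Fin D))
    (A₀ : Set (EuclideanSpace ℝ (Fin D))) (l i : ℕ) (v : EuclideanSpace ℝ (Fin D)) (u : ℝ)
    (A : Set (EuclideanSpace ℝ (Fin D))) : ℝ :=
  if Odd (l + i) then projMedian X A₀ v + u * (6 / Real.sqrt D) * dataDiam X A₀
  else projMedian X A v

/-- The tree after `i` rounds, ignoring the stopping rule. The pair `ω i` holds the random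
direction and the random number in `[-1, 1]` drawn in round `i + 1`. -/
def grow {D n : ℕ} (X : Fin n → EuclideanSpace ℝ (Fin D))
    (A₀ : Set (EuclideanSpace ℝ (Fin D))) (l : ℕ) (ω : ℕ → EuclideanSpace ℝ (Fin D) × ℝ) :
    ℕ → Tree D
  | 0 => .leaf A₀
  | i + 1 => (grow X A₀ l ω i).splitLeaves (ω i).1 (threshold X A₀ l (i + 1) (ω i).1 (ω i).2)

open scoped Classical in
/-- The procedure `basicRPtree(A₀, Δ, l)` on the sample `X`, run with the random draws `ω`: grow the
tree level by level, and return it as soon as the average data diameter of its leaf cells is at most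
`Δ`. The value is `none` if this never happens. -/
def basicRPtree {D n : ℕ} (X : Fin n → EuclideanSpace ℝ (Fin D))
    (A₀ : Set (EuclideanSpace ℝ (Fin D))) (Δ : ℝ) (l : ℕ)
    (ω : ℕ → EuclideanSpace ℝ (Fin D) × ℝ) : Option (Tree D) :=
  if h : ∃ i, avgDataDiam X (grow X A₀ l ω i).leaves ≤ Δ then some (grow X A₀ l ω (Nat.find h))
  else none

/-- The law of the random draws: in every round, independently of the other rounds, a direction
`v ∼ N(0, (1/D) I_D)` and, independently of `v`, a number `u` uniform in `[-1, 1]`. -/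
def drawLaw (D : ℕ) : Measure (ℕ → EuclideanSpace ℝ (Fin D) × ℝ) :=
  Measure.infinitePi fun _ =>
    (multivariateGaussian (0 : EuclideanSpace ℝ (Fin D))
      ((1 / (D : ℝ)) • (1 : Matrix (Fin D) (Fin D) ℝ))).prod (ProbabilityTheory.cond volume (Set.Icc (-1 : ℝ) 1))

end

end RPTree

/-!
The median splits are not needed: the noisy rounds alone bring the data diameter of *every* cell,
and hence the average, down to `Δ / 2`, where `Δ = Δ_n(A)`. In a noisy round all the cells are cut
by one and the same hyperplane, whose law does not depend on the earlier rounds. So it suffices to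
bound the probability that some pair of sample points at distance more than `Δ / 2` is never
separated by a noisy hyperplane.

To make the number of pairs independent of `n`, the sample in `A` is covered by `d ^ O(d)` pieces of
diameter at most `ρ`, of order `Δ / d` (`HasHalvingNumber.iterate`). Two pieces `T ∋ x` and
`T' ∋ x'` with `dist x x' > Δ / 2` are cleanly separated by a single noisy round with probability at
least an absolute constant (`roundLaw_separatingDraws`), for the following reasons:

* the projection of `x - x'` has size at least of order `Δ / √D`, by Gaussian anti-concentration
  (`dirLaw_anticoncentration`);
* the projections of `T` and `T'` have length at most a small multiple of `Δ / √D`, by a chaining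
  argument over the scales below `ρ` (`dirLaw_fluctuation`);
* the projected median is within `6 Δ / √D` of the projections of `x` and `x'`, because most of the
  projected sample is (`dirLaw_projMedian_far`); hence the gap between the projected pieces lies in
  the window of the noise and fills a constant fraction of it (`noise_separates`).

Independence of the rounds and a union bound over the `d ^ O(d)` pairs of pieces
(`drawLaw_exists_large_leaf`) show that `O(d log d)` noisy rounds suffice with probability at least
`1 / 2`. Dimensions below `1` occur only for samples with at most one point in `A`, where the
procedure stops at the root.
-/

namespace RPTree

variable {D n : ℕ}

/-! ### One-dimensional projections of the random direction -/

/-- The law `N(0, (1/D) I_D)` of the random direction. -/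
noncomputable abbrev dirLaw (D : ℕ) : Measure (EuclideanSpace ℝ (Fin D)) :=
  multivariateGaussian 0 ((1 / (D : ℝ)) • (1 : Matrix (Fin D) (Fin D) ℝ))

lemma map_inner_dirLaw (w : EuclideanSpace ℝ (Fin D)) :
    (dirLaw D).map (fun v => inner ℝ w v) = gaussianReal 0 (‖w‖ ^ 2 / D).toNNReal := by
  have hS : ((1 / (D : ℝ)) • (1 : Matrix (Fin D) (Fin D) ℝ)).PosSemidef :=
    Matrix.PosSemidef.one.smul (by positivity)
  have hid : MemLp id 2 (dirLaw D) := IsGaussian.memLp_two_id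
  have h := IsGaussian.map_eq_gaussianReal (μ := dirLaw D) (innerSL ℝ w)
  have h1 : Var[fun v => inner ℝ w v; dirLaw D] = ‖w‖ ^ 2 / D := by
    rw [← covarianceBilin_self hid, covarianceBilin_multivariateGaussian hS,
      EuclideanSpace.real_norm_sq_eq]
    simp [dotProduct, Matrix.smul_mulVec, div_eq_inv_mul, Finset.mul_sum]
    exact Finset.sum_congr rfl fun i _ => by ring
  have h2 : (dirLaw D)[innerSL ℝ w] = 0 := by
    rw [(innerSL ℝ w).integral_comp_id_comm IsGaussian.integrable_id,
      integral_id_multivariateGaussian, map_zero]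
  rw [h2] at h
  rw [← h1]
  exact h

lemma gaussianReal_abs_tail (c : NNReal) {ε : ℝ} (hε : 0 ≤ ε) :
    gaussianReal 0 c {x | ε ≤ |x|} ≤ ENNReal.ofReal (2 * Real.exp (-ε ^ 2 / (2 * c))) := by
  have hsub : ∀ Y : ℝ → ℝ, (gaussianReal 0 c).map Y = gaussianReal 0 c →
      HasSubgaussianMGF Y c (gaussianReal 0 c) := by
    intro Y hY
    have hYm : AEMeasurable Y (gaussianReal 0 c) := by
      by_contra h
      rw [Measure.map_of_not_aemeasurable h] at hY
      exact IsProbabilityMeasure.ne_zero (gaussianReal 0 c) hY.symm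
    refine ⟨fun t => ?_, fun t => ?_⟩
    · have := integrable_exp_mul_gaussianReal (μ := 0) (v := c) t
      rw [← hY] at this
      exact (integrable_map_measure (by fun_prop) hYm).1 this
    · rw [mgf_gaussianReal hY]; simp
  have key : ∀ Y : ℝ → ℝ, (gaussianReal 0 c).map Y = gaussianReal 0 c →
      gaussianReal 0 c {x | ε ≤ Y x} ≤ ENNReal.ofReal (Real.exp (-ε ^ 2 / (2 * c))) := by
    intro Y hY
    have := (hsub Y hY).measure_ge_le hε
    rw [← ENNReal.ofReal_toReal (measure_ne_top (gaussianReal 0 c) {x | ε ≤ Y x})]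
    exact ENNReal.ofReal_le_ofReal this
  calc gaussianReal 0 c {x | ε ≤ |x|}
      ≤ gaussianReal 0 c ({x | ε ≤ id x} ∪ {x | ε ≤ -x}) := by
        refine measure_mono fun x hx => ?_
        simpa [le_abs] using hx
    _ ≤ _ := measure_union_le _ _
    _ ≤ ENNReal.ofReal (Real.exp (-ε ^ 2 / (2 * c))) +
        ENNReal.ofReal (Real.exp (-ε ^ 2 / (2 * c))) := by
        gcongr
        · exact key id (by simp)
        · exact key (fun x => -x) (by simp [gaussianReal_map_neg])
    _ = _ := by
        rw [← ENNReal.ofReal_add (by positivity) (by positivity)]; congr 1; ring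

/-- Gaussian tail bound: along the random direction, a vector `w` of norm at most `ρ` has a
projection of absolute value larger than `a * ρ / √D` with probability at most
`2 exp (-a² / 2)`. -/
lemma dirLaw_tail {w : EuclideanSpace ℝ (Fin D)} {ρ a : ℝ} (hw : ‖w‖ ≤ ρ) (ha : 0 ≤ a) :
    dirLaw D {v | a * ρ / √D < |inner ℝ w v|} ≤ ENNReal.ofReal (2 * Real.exp (-a ^ 2 / 2)) := by
  have hρ : 0 ≤ ρ := (norm_nonneg w).trans hw
  rcases eq_or_ne w 0 with rfl | hw0
  · have : {v : EuclideanSpace ℝ (Fin D) | a * ρ / √D < |inner ℝ (0 : EuclideanSpace ℝ (Fin D)) v|}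
        = ∅ := by
      ext v
      simp only [inner_zero_left, abs_zero, Set.mem_ofPred_eq, Set.mem_empty_iff_false, iff_false,
        not_lt]
      positivity
    rw [this]; simp
  have hD : (0 : ℝ) < D := by
    rcases Nat.eq_zero_or_pos D with rfl | h
    · exact absurd (Subsingleton.elim w 0) hw0
    · exact_mod_cast h
  have hn : 0 < ‖w‖ := norm_pos_iff.2 hw0
  have hm : Measurable fun v : EuclideanSpace ℝ (Fin D) => (inner ℝ w v : ℝ) := by fun_prop
  calc dirLaw D {v | a * ρ / √D < |inner ℝ w v|}
      ≤ dirLaw D ((fun v => inner ℝ w v) ⁻¹' {x | a * ‖w‖ / √D ≤ |x|}) := by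
        refine measure_mono fun v hv => ?_
        simp only [Set.mem_ofPred_eq, Set.mem_preimage] at hv ⊢
        refine le_trans ?_ hv.le
        gcongr
    _ = gaussianReal 0 (‖w‖ ^ 2 / D).toNNReal {x | a * ‖w‖ / √D ≤ |x|} := by
        rw [← map_inner_dirLaw, Measure.map_apply hm]
        exact measurableSet_le measurable_const measurable_id.abs
    _ ≤ _ := gaussianReal_abs_tail _ (by positivity)
    _ = _ := by
        congr 3
        rw [Real.coe_toNNReal _ (by positivity), div_pow, mul_pow, Real.sq_sqrt hD.le]
        field_simp

/-- Gaussian anti-concentration, from the bound `1 / √(2πσ²)` on the density. -/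
lemma dirLaw_anticoncentration {w : EuclideanSpace ℝ (Fin D)} (hw : w ≠ 0) :
    dirLaw D {v | |inner ℝ w v| ≤ ‖w‖ / (2 * √D)} ≤ ENNReal.ofReal (2 / 5) := by
  have hD : (0 : ℝ) < D := by
    rcases Nat.eq_zero_or_pos D with rfl | h
    · exact absurd (Subsingleton.elim w 0) hw
    · exact_mod_cast h
  have hn : 0 < ‖w‖ := norm_pos_iff.2 hw
  have hm : Measurable fun v : EuclideanSpace ℝ (Fin D) => (inner ℝ w v : ℝ) := by fun_prop
  set σ : ℝ := ‖w‖ / √D with hσ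
  have hσ0 : 0 < σ := by positivity
  set c : NNReal := (‖w‖ ^ 2 / D).toNNReal with hc
  have hcσ : (c : ℝ) = σ ^ 2 := by
    rw [hc, Real.coe_toNNReal _ (by positivity), hσ, div_pow, Real.sq_sqrt hD.le]
  have hc0 : c ≠ 0 := by
    intro h
    rw [h] at hcσ
    have : 0 < σ ^ 2 := by positivity
    simp at hcσ
    exact this.ne hcσ
  have hset : {v : EuclideanSpace ℝ (Fin D) | |inner ℝ w v| ≤ ‖w‖ / (2 * √D)} =
      (fun v => inner ℝ w v) ⁻¹' Set.Icc (-(σ / 2)) (σ / 2) := by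
    ext v
    simp only [Set.mem_ofPred_eq, Set.mem_preimage, Set.mem_Icc, ← abs_le]
    rw [hσ, div_div, mul_comm (√D) 2]
  rw [hset, ← Measure.map_apply hm measurableSet_Icc, map_inner_dirLaw, gaussianReal_apply _ hc0]
  have hpdf : ∀ x, gaussianPDF 0 c x ≤ ENNReal.ofReal (2 / (5 * σ)) := by
    intro x
    refine ENNReal.ofReal_le_ofReal ?_
    rw [gaussianPDFReal_def, hcσ, Real.sqrt_mul (by positivity), Real.sqrt_sq hσ0.le]
    have h1 : Real.exp (-(x - 0) ^ 2 / (2 * σ ^ 2)) ≤ 1 := by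
      rw [Real.exp_le_one_iff]
      exact div_nonpos_of_nonpos_of_nonneg (by nlinarith [sq_nonneg (x - 0)]) (by positivity)
    have h2 : (5 / 2 : ℝ) ≤ √(2 * Real.pi) := by
      apply Real.le_sqrt_of_sq_le
      nlinarith [Real.pi_gt_d2]
    calc (√(2 * Real.pi) * σ)⁻¹ * Real.exp (-(x - 0) ^ 2 / (2 * σ ^ 2))
        ≤ (5 / 2 * σ)⁻¹ * 1 := by gcongr
      _ = 2 / (5 * σ) := by field_simp
  calc ∫⁻ x in Set.Icc (-(σ / 2)) (σ / 2), gaussianPDF 0 c x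
      ≤ ∫⁻ _ in Set.Icc (-(σ / 2)) (σ / 2), ENNReal.ofReal (2 / (5 * σ)) :=
        lintegral_mono hpdf
    _ = ENNReal.ofReal (2 / (5 * σ)) * ENNReal.ofReal (σ / 2 - -(σ / 2)) := by
        rw [setLIntegral_const, Real.volume_Icc]
    _ = ENNReal.ofReal (2 / 5) := by
        rw [← ENNReal.ofReal_mul (by positivity)]
        congr 1
        field_simp
        ring

/-! ### Covering numbers -/

/-- `S` has halving number `N`: every subset of `S` of diameter at most `ρ` can be covered by at
most `N` of its subsets of diameter at most `ρ / 2`. Diameter bounds are written out over pairs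
of points. -/
def HasHalvingNumber {E : Type*} [PseudoMetricSpace E] (S : Set E) (N : ℝ) : Prop :=
  ∀ T ⊆ S, ∀ ρ : ℝ, 0 < ρ → (∀ x ∈ T, ∀ y ∈ T, dist x y ≤ ρ) →
    ∃ P : Finset (Set E), (P.card : ℝ) ≤ N ∧ T ⊆ ⋃ U ∈ P, U ∧
      ∀ U ∈ P, U ⊆ T ∧ ∀ x ∈ U, ∀ y ∈ U, dist x y ≤ ρ / 2

open scoped Classical in
/-- Balls of radius `r` have diameter `2 r`, so the covering property is used twice to halve
diameters. -/
lemma HasAssouadDim.hasHalvingNumber {S : Set (EuclideanSpace ℝ (Fin D))} {d : ℝ}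
    (h : HasAssouadDim S d) : HasHalvingNumber S ((2 : ℝ) ^ d * (2 : ℝ) ^ d) := by
  intro T hTS ρ hρ hT
  rcases T.eq_empty_or_nonempty with rfl | ⟨x, hx⟩
  · exact ⟨∅, by simp; positivity, by simp, by simp⟩
  obtain ⟨⟨-, hcov⟩, -⟩ := h
  obtain ⟨C, hC, hCS⟩ := hcov x ρ hρ
  choose! C' hC' hCS' using fun c => hcov c (ρ / 2) (by positivity)
  refine ⟨(C.biUnion C').image fun c => Metric.closedBall c (ρ / 2 / 2) ∩ T, ?_, ?_, ?_⟩
  · calc ((((C.biUnion C').image fun c => Metric.closedBall c (ρ / 2 / 2) ∩ T).card : ℕ) : ℝ)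
        ≤ ((∑ c ∈ C, (C' c).card : ℕ) : ℝ) := by
          exact_mod_cast Finset.card_image_le.trans Finset.card_biUnion_le
      _ ≤ ∑ c ∈ C, (2 : ℝ) ^ d := by
          push_cast
          exact Finset.sum_le_sum fun c _ => hC' c
      _ = C.card * (2 : ℝ) ^ d := by simp
      _ ≤ _ := by gcongr
  · intro y hy
    have h1 := hCS ⟨Metric.mem_closedBall.2 (hT y hy x hx), hTS hy⟩
    simp only [Set.mem_iUnion] at h1
    obtain ⟨c, hc, hyc⟩ := h1
    have h2 := hCS' c ⟨hyc, hTS hy⟩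
    simp only [Set.mem_iUnion] at h2
    obtain ⟨c', hc', hyc'⟩ := h2
    simp only [Set.mem_iUnion, Finset.mem_image, Finset.mem_biUnion, exists_prop]
    exact ⟨_, ⟨c', ⟨c, hc, hc'⟩, rfl⟩, hyc', hy⟩
  · intro U hU
    simp only [Finset.mem_image] at hU
    obtain ⟨c, -, rfl⟩ := hU
    refine ⟨Set.inter_subset_right, fun y hy z hz => ?_⟩
    have h1 := Metric.mem_closedBall.1 hy.1
    have h2 := Metric.mem_closedBall'.1 hz.1
    linarith [dist_triangle y c z]

open scoped Classical in
lemma HasHalvingNumber.iterate {E : Type*} [PseudoMetricSpace E] {S : Set E} {N : ℝ}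
    (h : HasHalvingNumber S N) (hN : 0 ≤ N) {T : Set E} (hTS : T ⊆ S) {ρ : ℝ} (hρ : 0 < ρ)
    (hT : ∀ x ∈ T, ∀ y ∈ T, dist x y ≤ ρ) (k : ℕ) :
    ∃ P : Finset (Set E), (P.card : ℝ) ≤ N ^ k ∧ T ⊆ ⋃ U ∈ P, U ∧
      ∀ U ∈ P, U ⊆ T ∧ ∀ x ∈ U, ∀ y ∈ U, dist x y ≤ ρ / 2 ^ k := by
  induction k with
  | zero => exact ⟨{T}, by simp, by simp, by simpa using hT⟩
  | succ k ih =>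
    obtain ⟨P, hPc, hPT, hP⟩ := ih
    choose! Q hQc hQT hQ using fun U (hU : U ∈ P) =>
      h U ((hP U hU).1.trans hTS) (ρ / 2 ^ k) (by positivity) (hP U hU).2
    refine ⟨P.biUnion Q, ?_, ?_, ?_⟩
    · calc (((P.biUnion Q).card : ℕ) : ℝ) ≤ ((∑ U ∈ P, (Q U).card : ℕ) : ℝ) := by
            exact_mod_cast Finset.card_biUnion_le
        _ ≤ ∑ U ∈ P, N := by
            push_cast
            exact Finset.sum_le_sum fun U hU => hQc U hU
        _ = P.card * N := by simp
        _ ≤ N ^ (k + 1) := by rw [pow_succ]; gcongr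
    · intro y hy
      have h1 := hPT hy
      simp only [Set.mem_iUnion] at h1
      obtain ⟨U, hU, hyU⟩ := h1
      have h2 := hQT U hU hyU
      simp only [Set.mem_iUnion] at h2
      obtain ⟨V, hV, hyV⟩ := h2
      simp only [Set.mem_iUnion, Finset.mem_biUnion, exists_prop]
      exact ⟨V, ⟨U, hU, hV⟩, hyV⟩
    · intro V hV
      obtain ⟨U, hU, hVU⟩ := Finset.mem_biUnion.1 hV
      refine ⟨(hQ U hU V hVU).1.trans (hP U hU).1, fun x hx y hy => ?_⟩
      rw [pow_succ, ← div_div]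
      exact (hQ U hU V hVU).2 x hx y hy

/-- Covering numbers are integers, so fewer than `2 ^ 1` balls means at most `2 ^ 0` of them, and
minimality forces the dimension to be `0`. -/
lemma HasAssouadDim.eq_zero_of_lt_one {S : Set (EuclideanSpace ℝ (Fin D))} {d : ℝ}
    (h : HasAssouadDim S d) (hd : d < 1) : d = 0 := by
  obtain ⟨⟨h0, hcov⟩, hmin⟩ := h
  refine le_antisymm (hmin ⟨le_rfl, fun x r hr => ?_⟩) h0
  obtain ⟨T, hT, hTc⟩ := hcov x r hr
  refine ⟨T, ?_, hTc⟩
  have : (T.card : ℝ) < 2 :=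
    hT.trans_lt (by simpa using Real.rpow_lt_rpow_of_exponent_lt one_lt_two hd)
  have h2 : T.card < 2 := by exact_mod_cast this
  simpa using (by omega : T.card ≤ 1)

/-- Such a set has dimension `0`, and iterated halving with a single piece puts all of it into sets
of arbitrarily small diameter. -/
lemma HasAssouadDim.subsingleton_of_lt_one {S : Set (EuclideanSpace ℝ (Fin D))} {d : ℝ}
    (h : HasAssouadDim S d) (hd : d < 1) (hS : Bornology.IsBounded S) : S.Subsingleton := by
  have hd0 := h.eq_zero_of_lt_one hd
  subst hd0
  intro x hx y hy
  by_contra hxy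
  have hhalf := h.hasHalvingNumber
  have hdist : 0 < dist x y := dist_pos.2 hxy
  have hdiam : ∀ a ∈ S, ∀ b ∈ S, dist a b ≤ Metric.diam S := fun a ha b hb =>
    Metric.dist_le_diam_of_mem hS ha hb
  have hpos : 0 < Metric.diam S := hdist.trans_le (hdiam x hx y hy)
  obtain ⟨k, hk⟩ := exists_pow_lt_of_lt_one (div_pos hdist hpos) (by norm_num : (1 / 2 : ℝ) < 1)
  obtain ⟨P, hPc, hPS, hP⟩ := hhalf.iterate (by positivity) subset_rfl hpos hdiam k
  have hcard : P.card ≤ 1 := by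
    have : (P.card : ℝ) ≤ 1 := by simpa using hPc
    exact_mod_cast this
  have h1 := hPS hx
  have h2 := hPS hy
  simp only [Set.mem_iUnion] at h1 h2
  obtain ⟨U, hU, hxU⟩ := h1
  obtain ⟨V, hV, hyV⟩ := h2
  obtain rfl := Finset.card_le_one.1 hcard U hU V hV
  have h3 := (hP U hU).2 x hxU y hyV
  have h4 : Metric.diam S / 2 ^ k < dist x y := by
    rw [lt_div_iff₀ hpos] at hk
    calc Metric.diam S / 2 ^ k = (1 / 2) ^ k * Metric.diam S := by
          rw [one_div, inv_pow]; ring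
      _ < _ := hk
  linarith

/-! ### Chaining -/

/-- Chaining: a set of diameter at most `ρ` with halving number at most `exp (b / 2) / 4` projects
onto the random direction into an interval of half-length `t * ρ / √D`, up to probability
`exp (b - t)`. The induction is on the number `k` of scales between `ρ` and the smallest distance
between points of `S`; the bound does not depend on `k`. -/
lemma dirLaw_fluctuation {S : Set (EuclideanSpace ℝ (Fin D))} {N b : ℝ}
    (hS : HasHalvingNumber S N) (hb : 64 ≤ b) (hN : 4 * N ≤ Real.exp (b / 2)) (k : ℕ) :
    ∀ T ⊆ S, ∀ ρ : ℝ, 0 < ρ → (∀ x ∈ T, ∀ y ∈ T, dist x y ≤ ρ) →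
      (∀ x ∈ S, ∀ y ∈ S, x ≠ y → ρ / 2 ^ k < dist x y) → ∀ x ∈ T, ∀ t : ℝ,
      dirLaw D {v | ∃ z ∈ T, t * ρ / √D < |inner ℝ (z - x) v|} ≤
        ENNReal.ofReal (Real.exp (b - t)) := by
  induction k with
  | zero =>
    intro T hTS ρ hρ hT hsep x hx t
    have hTx : ∀ z ∈ T, z = x := fun z hz => by
      by_contra hne
      have := hsep z (hTS hz) x (hTS hx) hne
      have := hT z hz x hx
      simp at *
      linarith
    rcases le_total t b with ht | ht
    · refine prob_le_one.trans ?_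
      rw [ENNReal.one_le_ofReal]
      exact Real.one_le_exp (by linarith)
    · have : {v : EuclideanSpace ℝ (Fin D) | ∃ z ∈ T, t * ρ / √D < |inner ℝ (z - x) v|} = ∅ := by
        refine Set.eq_empty_of_forall_notMem ?_
        rintro v ⟨z, hz, hv⟩
        rw [hTx z hz, sub_self, inner_zero_left, abs_zero] at hv
        exact absurd hv (not_lt.2 (by have : 0 ≤ t := by linarith
                                      positivity))
      rw [this]; simp
  | succ k ih =>
    intro T hTS ρ hρ hT hsep x hx t
    rcases le_total t b with ht | ht
    · refine prob_le_one.trans ?_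
      rw [ENNReal.one_le_ofReal]
      exact Real.one_le_exp (by linarith)
    have ht0 : 0 ≤ t := by linarith
    obtain ⟨P, hPN, hTP, hP⟩ := hS T hTS ρ hρ hT
    -- A link from `x` to a point `y` of the piece `U` uses a quarter of the allowed deviation; the
    -- remaining `3 / 4` of it is `3 / 2 * t` at the scale `ρ / 2` of `U`.
    have hpiece : ∀ U ∈ P,
        dirLaw D {v | ∃ z ∈ U, t * ρ / √D < |inner ℝ (z - x) v|} ≤
          ENNReal.ofReal (2 * Real.exp (-(t / 4) ^ 2 / 2) + Real.exp (b - 3 / 2 * t)) := by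
      intro U hU
      rcases U.eq_empty_or_nonempty with rfl | ⟨y, hy⟩
      · simp
      have hUT := (hP U hU).1
      have h1 : dirLaw D {v | t / 4 * ρ / √D < |inner ℝ (y - x) v|} ≤ _ :=
        dirLaw_tail (w := y - x) (by rw [← dist_eq_norm]; exact hT y (hUT hy) x hx)
          (by positivity : 0 ≤ t / 4)
      have h2 := ih U (hUT.trans hTS) (ρ / 2) (by positivity) (hP U hU).2
        (fun p hp q hq hpq => by
          have := hsep p hp q hq hpq
          rwa [pow_succ', ← div_div] at this) y hy (3 / 2 * t)
      rw [ENNReal.ofReal_add (by positivity) (by positivity)]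
      refine le_trans (le_trans (measure_mono ?_) (measure_union_le _ _)) (add_le_add h1 h2)
      rintro v ⟨z, hz, hv⟩
      by_contra hcon
      simp only [Set.mem_union, Set.mem_ofPred_eq, not_or, not_lt, not_exists, not_and] at hcon
      obtain ⟨h3, h4⟩ := hcon
      have h5 := h4 z hz
      have h6 : inner ℝ (z - x) v = inner ℝ (y - x) v + inner ℝ (z - y) v := by
        rw [← inner_add_left]; congr 1; abel
      rw [h6] at hv
      have h7 := hv.trans_le (abs_add_le _ _)
      have h8 : t * ρ / √D = t / 4 * ρ / √D + 3 / 2 * t * (ρ / 2) / √D := by ring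
      linarith
    calc dirLaw D {v | ∃ z ∈ T, t * ρ / √D < |inner ℝ (z - x) v|}
        ≤ dirLaw D (⋃ U ∈ P, {v | ∃ z ∈ U, t * ρ / √D < |inner ℝ (z - x) v|}) := by
          refine measure_mono ?_
          rintro v ⟨z, hz, hv⟩
          have := hTP hz
          simp only [Set.mem_iUnion] at this ⊢
          obtain ⟨U, hU, hzU⟩ := this
          exact ⟨U, hU, z, hzU, hv⟩
      _ ≤ ∑ U ∈ P, dirLaw D {v | ∃ z ∈ U, t * ρ / √D < |inner ℝ (z - x) v|} :=
          measure_biUnion_finset_le _ _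
      _ ≤ ∑ U ∈ P, ENNReal.ofReal (2 * Real.exp (-(t / 4) ^ 2 / 2) + Real.exp (b - 3 / 2 * t)) :=
          Finset.sum_le_sum hpiece
      _ = ENNReal.ofReal
            (P.card * (2 * Real.exp (-(t / 4) ^ 2 / 2) + Real.exp (b - 3 / 2 * t))) := by
          rw [Finset.sum_const, nsmul_eq_mul, ENNReal.ofReal_mul (by positivity)]
          simp
      _ ≤ ENNReal.ofReal (Real.exp (b - t)) := by
          refine ENNReal.ofReal_le_ofReal ?_
          have hPb : (P.card : ℝ) ≤ Real.exp (b / 2) / 4 := by linarith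
          have e1 : Real.exp (-(t / 4) ^ 2 / 2) ≤ Real.exp (b / 2 - t) :=
            Real.exp_le_exp.2 (by nlinarith)
          have e2 : Real.exp (b - 3 / 2 * t) ≤ Real.exp (b / 2 - t) :=
            Real.exp_le_exp.2 (by linarith)
          calc (P.card : ℝ) * (2 * Real.exp (-(t / 4) ^ 2 / 2) + Real.exp (b - 3 / 2 * t))
              ≤ Real.exp (b / 2) / 4 * (2 * Real.exp (b / 2 - t) + Real.exp (b / 2 - t)) := by
                gcongr
            _ = 3 / 4 * Real.exp (b - t) := by
                rw [show b - t = b / 2 + (b / 2 - t) by ring, Real.exp_add]; ring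
            _ ≤ Real.exp (b - t) := by linarith [Real.exp_pos (b - t)]

/-- For a finite set the separation hypothesis of `dirLaw_fluctuation` holds at some scale. -/
lemma dirLaw_fluctuation_of_finite {S : Set (EuclideanSpace ℝ (Fin D))} (hfin : S.Finite) {N b : ℝ}
    (hS : HasHalvingNumber S N) (hb : 64 ≤ b) (hN : 4 * N ≤ Real.exp (b / 2))
    {T : Set (EuclideanSpace ℝ (Fin D))} (hTS : T ⊆ S) {ρ : ℝ} (hρ : 0 < ρ)
    (hT : ∀ x ∈ T, ∀ y ∈ T, dist x y ≤ ρ) {x : EuclideanSpace ℝ (Fin D)} (hx : x ∈ T) (t : ℝ) :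
    dirLaw D {v | ∃ z ∈ T, t * ρ / √D < |inner ℝ (z - x) v|} ≤
      ENNReal.ofReal (Real.exp (b - t)) := by
  have hfin2 : S.offDiag.Finite := hfin.offDiag
  obtain ⟨δ, hδ, hsep⟩ : ∃ δ > 0, ∀ p ∈ S, ∀ q ∈ S, p ≠ q → δ ≤ dist p q := by
    rcases S.offDiag.eq_empty_or_nonempty with h | h
    · exact ⟨1, one_pos, fun p hp q hq hpq => absurd (h ▸ ⟨hp, hq, hpq⟩ : (p, q) ∈ (∅ : Set _))
        (Set.notMem_empty _)⟩
    · obtain ⟨a, ha, hmin⟩ := hfin2.exists_minimalFor (fun p => dist p.1 p.2) _ h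
      refine ⟨dist a.1 a.2, dist_pos.2 ha.2.2, fun p hp q hq hpq => ?_⟩
      exact le_of_not_gt fun hlt =>
        absurd (hmin (j := (p, q)) ⟨hp, hq, hpq⟩ hlt.le) (not_le.2 hlt)
  obtain ⟨k, hk⟩ := exists_pow_lt_of_lt_one (div_pos hδ hρ) (by norm_num : (1 / 2 : ℝ) < 1)
  refine dirLaw_fluctuation hS hb hN k T hTS ρ hρ hT (fun p hp q hq hpq => ?_) x hx t
  refine lt_of_lt_of_le ?_ (hsep p hp q hq hpq)
  rw [lt_div_iff₀ hρ] at hk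
  calc ρ / 2 ^ k = (1 / 2) ^ k * ρ := by rw [one_div, inv_pow]; ring
    _ < δ := hk

/-! ### Medians -/

lemma median_coe_of_pairwise {l : List ℝ} (hl : l.Pairwise (· ≤ ·)) :
    median (l : Multiset ℝ) = (l.getD ((l.length - 1) / 2) 0 + l.getD (l.length / 2) 0) / 2 := by
  have h : (l : Multiset ℝ).sort (· ≤ ·) = l := by
    rw [Multiset.coe_sort]
    exact List.mergeSort_of_pairwise (by simpa using hl)
  unfold median
  rw [h, Multiset.coe_card]

open scoped Classical in
/-- An interval that contains more than half of the entries contains the median. -/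
lemma median_mem_Icc {s : Multiset ℝ} {α β : ℝ}
    (h : s.card < 2 * s.countP (fun x => x ∈ Set.Icc α β)) : median s ∈ Set.Icc α β := by
  set l := s.sort (· ≤ ·) with hl
  have hs : s = (l : Multiset ℝ) := (Multiset.sort_eq s (· ≤ ·)).symm
  have hsort : l.Pairwise (· ≤ ·) := Multiset.pairwise_sort _ _
  clear_value l
  subst hs
  rw [Multiset.coe_card, Multiset.coe_countP] at h
  rw [median_coe_of_pairwise hsort]
  have hcount : l.countP (fun x => x ∈ Set.Icc α β) ≤ l.length := List.countP_le_length
  have hj : (l.length - 1) / 2 < l.length := by omega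
  have hk : l.length / 2 < l.length := by omega
  have hjk : (l.length - 1) / 2 ≤ l.length / 2 := by omega
  rw [List.getD_eq_getElem _ _ hj, List.getD_eq_getElem _ _ hk]
  have hmono : ∀ i j (hi : i < l.length) (hj : j < l.length), i ≤ j → l[i] ≤ l[j] := by
    intro i j hi hj hij
    rcases hij.eq_or_lt with rfl | hlt
    · exact le_rfl
    · exact List.pairwise_iff_getElem.1 hsort i j hi hj hlt
  have hlow : α ≤ l[(l.length - 1) / 2] := by
    by_contra hlt
    push Not at hlt
    have h0 : (l.take ((l.length - 1) / 2 + 1)).countP (fun x => x ∈ Set.Icc α β) = 0 := by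
      rw [List.countP_eq_zero]
      intro x hx
      obtain ⟨i, hi, rfl⟩ := List.mem_iff_getElem.1 hx
      rw [List.length_take] at hi
      rw [List.getElem_take]
      have := hmono i _ (by omega) hj (by omega)
      simp only [Set.mem_Icc, decide_eq_true_eq, not_and]
      intro h'
      linarith
    have h1 : (l.drop ((l.length - 1) / 2 + 1)).countP (fun x => x ∈ Set.Icc α β) ≤ _ :=
      List.countP_le_length
    rw [List.length_drop] at h1
    have h2 := List.countP_append (p := fun x => decide (x ∈ Set.Icc α β))
      (l₁ := l.take ((l.length - 1) / 2 + 1)) (l₂ := l.drop ((l.length - 1) / 2 + 1))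
    rw [List.take_append_drop] at h2
    omega
  have hhigh : l[l.length / 2] ≤ β := by
    by_contra hlt
    push Not at hlt
    have h0 : (l.drop (l.length / 2)).countP (fun x => x ∈ Set.Icc α β) = 0 := by
      rw [List.countP_eq_zero]
      intro x hx
      obtain ⟨i, hi, rfl⟩ := List.mem_iff_getElem.1 hx
      rw [List.length_drop] at hi
      rw [List.getElem_drop]
      have := hmono _ (l.length / 2 + i) hk (by omega) (by omega)
      simp only [Set.mem_Icc, decide_eq_true_eq, not_and]
      intro _ h'
      linarith
    have h1 : (l.take (l.length / 2)).countP (fun x => x ∈ Set.Icc α β) ≤ _ :=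
      List.countP_le_length
    rw [List.length_take] at h1
    have h2 := List.countP_append (p := fun x => decide (x ∈ Set.Icc α β))
      (l₁ := l.take (l.length / 2)) (l₂ := l.drop (l.length / 2))
    rw [List.take_append_drop] at h2
    omega
  have := hmono _ _ hj hk hjk
  constructor <;> linarith

/-- On the set of directions along which a given ordering of the sample points is sorted, the median
is an explicit measurable function; there are countably many orderings. -/
lemma measurable_projMedian (X : Fin n → EuclideanSpace ℝ (Fin D))
    (A : Set (EuclideanSpace ℝ (Fin D))) : Measurable (projMedian X A) := by
  classical
  set F : Finset (Fin n) := Finset.univ.filter fun i => X i ∈ A with hF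
  let f : EuclideanSpace ℝ (Fin D) → Fin n → ℝ := fun v i => inner ℝ (X i) v
  let g : List (Fin n) → EuclideanSpace ℝ (Fin D) → ℝ := fun l v =>
    ((l.map (f v)).getD ((l.length - 1) / 2) 0 + (l.map (f v)).getD (l.length / 2) 0) / 2
  have hf : ∀ i, Measurable fun v => f v i := fun i => by fun_prop
  have hgetD : ∀ (l : List (Fin n)) (j : ℕ), Measurable fun v => (l.map (f v)).getD j 0 := by
    intro l j
    simp only [List.getD_eq_getElem?_getD, List.getElem?_map]
    cases l[j]? with
    | none => exact measurable_const
    | some i => exact hf i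
  have hg : ∀ l, Measurable (g l) := fun l => ((hgetD l _).add (hgetD l _)).div_const 2
  have hsorted : ∀ l : List (Fin n), MeasurableSet {v | (l.map (f v)).Pairwise (· ≤ ·)} := by
    intro l
    simp only [List.pairwise_map]
    induction l with
    | nil => simp
    | cons a l ih =>
      simp only [List.pairwise_cons]
      have : {v | (∀ a' ∈ l, f v a ≤ f v a') ∧ l.Pairwise fun i j => f v i ≤ f v j} =
          (⋂ a', ⋂ (_ : a' ∈ l), {v | f v a ≤ f v a'}) ∩
            {v | l.Pairwise fun i j => f v i ≤ f v j} := by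
        ext v; simp
      rw [this]
      exact (MeasurableSet.iInter fun a' => MeasurableSet.iInter fun _ =>
        measurableSet_le (hf a) (hf a')).inter ih
  have hval : ∀ (l : List (Fin n)) (v), (l : Multiset (Fin n)) = F.val →
      (l.map (f v)).Pairwise (· ≤ ·) → projMedian X A v = g l v := by
    intro l v hl hs
    have h1 : projMedian X A v = median (F.val.map (f v)) := rfl
    rw [h1, ← hl, Multiset.map_coe, median_coe_of_pairwise hs, List.length_map]
  have hex : ∀ v, ∃ l : List (Fin n), (l : Multiset (Fin n)) = F.val ∧
      (l.map (f v)).Pairwise (· ≤ ·) := by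
    intro v
    refine ⟨F.toList.mergeSort (fun i j => decide (f v i ≤ f v j)), ?_, ?_⟩
    · rw [← Finset.coe_toList F]
      exact Multiset.coe_eq_coe.2 (List.mergeSort_perm _ _)
    · rw [List.pairwise_map]
      have := List.pairwise_mergeSort (le := fun i j => decide (f v i ≤ f v j))
        (fun a b c hab hbc => by simp at *; linarith)
        (fun a b => by simpa using le_total _ _) F.toList
      simpa using this
  intro B hB
  have : projMedian X A ⁻¹' B = ⋃ l : List (Fin n), ⋃ (_ : (l : Multiset (Fin n)) = F.val),
      ({v | (l.map (f v)).Pairwise (· ≤ ·)} ∩ g l ⁻¹' B) := by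
    ext v
    simp only [Set.mem_preimage, Set.mem_iUnion, Set.mem_inter_iff, Set.mem_ofPred_eq, exists_prop]
    constructor
    · intro hv
      obtain ⟨l, hl, hs⟩ := hex v
      exact ⟨l, hl, hs, hval l v hl hs ▸ hv⟩
    · rintro ⟨l, hl, hs, hv⟩
      rwa [hval l v hl hs]
  rw [this]
  exact MeasurableSet.iUnion fun l => MeasurableSet.iUnion fun _ =>
    (hsorted l).inter (hg l hB)

/-! ### One noisy split -/

/-- The law of the draw `(v, u)` of a single round. -/
noncomputable abbrev roundLaw (D : ℕ) : Measure (EuclideanSpace ℝ (Fin D) × ℝ) :=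
  (dirLaw D).prod (ProbabilityTheory.cond volume (Set.Icc (-1 : ℝ) 1))

instance isProbabilityMeasure_uniform :
    IsProbabilityMeasure (ProbabilityTheory.cond volume (Set.Icc (-1 : ℝ) 1)) :=
  cond_isProbabilityMeasure_of_finite (by simp) (by simp)

/-- The common threshold of all the cells in a noisy round with draw `p = (v, u)`. -/
noncomputable def noisyThreshold (X : Fin n → EuclideanSpace ℝ (Fin D))
    (A : Set (EuclideanSpace ℝ (Fin D))) (p : EuclideanSpace ℝ (Fin D) × ℝ) : ℝ :=
  projMedian X A p.1 + p.2 * (6 / √D) * dataDiam X A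

/-- The draws for which the hyperplane of a noisy round has `T` on one side and `T'` on the
other. -/
def separatingDraws (X : Fin n → EuclideanSpace ℝ (Fin D))
    (A T T' : Set (EuclideanSpace ℝ (Fin D))) :
    Set (EuclideanSpace ℝ (Fin D) × ℝ) :=
  {p | ((∀ z ∈ T, inner ℝ z p.1 ≤ noisyThreshold X A p) ∧
        ∀ z ∈ T', noisyThreshold X A p < inner ℝ z p.1) ∨
      ((∀ z ∈ T', inner ℝ z p.1 ≤ noisyThreshold X A p) ∧
        ∀ z ∈ T, noisyThreshold X A p < inner ℝ z p.1)}

lemma measurable_noisyThreshold (X : Fin n → EuclideanSpace ℝ (Fin D))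
    (A : Set (EuclideanSpace ℝ (Fin D))) : Measurable (noisyThreshold X A) :=
  ((measurable_projMedian X A).comp measurable_fst).add
    ((measurable_snd.mul_const _).mul_const _)

lemma measurableSet_separatingDraws (X : Fin n → EuclideanSpace ℝ (Fin D))
    (A : Set (EuclideanSpace ℝ (Fin D))) {T T' : Set (EuclideanSpace ℝ (Fin D))} (hT : T.Countable)
    (hT' : T'.Countable) : MeasurableSet (separatingDraws X A T T') := by
  have hin : ∀ z : EuclideanSpace ℝ (Fin D),
      Measurable fun p : EuclideanSpace ℝ (Fin D) × ℝ => (inner ℝ z p.1 : ℝ) := fun z => by fun_prop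
  have hle : ∀ {U : Set (EuclideanSpace ℝ (Fin D))}, U.Countable →
      MeasurableSet {p | ∀ z ∈ U, inner ℝ z p.1 ≤ noisyThreshold X A p} := by
    intro U hU
    have : {p | ∀ z ∈ U, inner ℝ z p.1 ≤ noisyThreshold X A p} =
        ⋂ z ∈ U, {p | inner ℝ z p.1 ≤ noisyThreshold X A p} := by ext; simp
    rw [this]
    exact MeasurableSet.biInter hU fun z _ =>
      measurableSet_le (hin z) (measurable_noisyThreshold X A)
  have hlt : ∀ {U : Set (EuclideanSpace ℝ (Fin D))}, U.Countable →
      MeasurableSet {p | ∀ z ∈ U, noisyThreshold X A p < inner ℝ z p.1} := by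
    intro U hU
    have : {p | ∀ z ∈ U, noisyThreshold X A p < inner ℝ z p.1} =
        ⋂ z ∈ U, {p | noisyThreshold X A p < inner ℝ z p.1} := by ext; simp
    rw [this]
    exact MeasurableSet.biInter hU fun z _ =>
      measurableSet_lt (measurable_noisyThreshold X A) (hin z)
  exact ((hle hT).inter (hlt hT')).union ((hle hT').inter (hlt hT))

lemma uniform_Ioo {a b : ℝ} (ha : -1 ≤ a) (hb : b ≤ 1) (hab : 1 / 48 ≤ b - a) :
    ENNReal.ofReal (1 / 96) ≤ ProbabilityTheory.cond volume (Set.Icc (-1 : ℝ) 1) (Set.Ioo a b) := by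
  have hsub : Set.Ioo a b ⊆ Set.Icc (-1) 1 := fun x hx => ⟨ha.trans hx.1.le, hx.2.le.trans hb⟩
  rw [cond_apply measurableSet_Icc, Set.inter_eq_self_of_subset_right hsub, Real.volume_Icc,
    Real.volume_Ioo, ← ENNReal.ofReal_inv_of_pos (by norm_num),
    ← ENNReal.ofReal_mul (by norm_num)]
  refine ENNReal.ofReal_le_ofReal ?_
  linarith

/-- Markov's inequality for the number of events of a finite family that occur. -/
lemma measure_half_le_count {Ω ι : Type*} [MeasurableSpace Ω] (μ : Measure Ω) {F : Finset ι}
    (hF : F.Nonempty) (p : ι → Ω → Prop) [∀ i ω, Decidable (p i ω)]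
    (hp : ∀ i, MeasurableSet {ω | p i ω}) {q : ℝ≥0∞} (hq : ∀ i ∈ F, μ {ω | p i ω} ≤ q) :
    μ {ω | F.card ≤ 2 * (F.filter fun i => p i ω).card} ≤ 2 * q := by
  have h1 : ∀ ω, (∑ i ∈ F, {ω | p i ω}.indicator (1 : Ω → ℝ≥0∞) ω) =
      ((F.filter fun i => p i ω).card : ℝ≥0∞) := by
    intro ω
    rw [Finset.card_filter]
    push_cast
    exact Finset.sum_congr rfl fun i _ => by simp [Set.indicator_apply]
  have h2 : ∫⁻ ω, (∑ i ∈ F, {ω | p i ω}.indicator (1 : Ω → ℝ≥0∞) ω) ∂μ ≤ F.card * q := by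
    rw [lintegral_finsetSum _ fun i _ => measurable_one.indicator (hp i)]
    calc ∑ i ∈ F, ∫⁻ ω, {ω | p i ω}.indicator (1 : Ω → ℝ≥0∞) ω ∂μ
        ≤ ∑ _i ∈ F, q := Finset.sum_le_sum fun i hi => by
          rw [lintegral_indicator_one (hp i)]; exact hq i hi
      _ = F.card * q := by simp
  have h3 := mul_meas_ge_le_lintegral (μ := μ)
    (Finset.measurable_sum F fun i _ => measurable_one.indicator (hp i) :
      Measurable fun ω => ∑ i ∈ F, {ω | p i ω}.indicator (1 : Ω → ℝ≥0∞) ω) ((F.card : ℝ≥0∞) / 2)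
  have hc0 : (F.card : ℝ≥0∞) ≠ 0 := by simpa using hF.ne_empty
  have hset : {ω | F.card ≤ 2 * (F.filter fun i => p i ω).card} ⊆
      {ω | (F.card : ℝ≥0∞) / 2 ≤ ∑ i ∈ F, {ω | p i ω}.indicator (1 : Ω → ℝ≥0∞) ω} := by
    intro ω hω
    simp only [Set.mem_ofPred_eq] at hω ⊢
    have h := h1 ω
    rw [h]
    refine ENNReal.div_le_of_le_mul' ?_
    exact_mod_cast hω
  have h4 : (F.card : ℝ≥0∞) / 2 * μ {ω | F.card ≤ 2 * (F.filter fun i => p i ω).card} ≤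
      F.card * q := (mul_le_mul_right (measure_mono hset) _).trans (h3.trans h2)
  have h5 : (F.card : ℝ≥0∞) * μ {ω | F.card ≤ 2 * (F.filter fun i => p i ω).card} ≤
      F.card * (2 * q) := by
    calc (F.card : ℝ≥0∞) * μ {ω | F.card ≤ 2 * (F.filter fun i => p i ω).card}
        = 2 * ((F.card : ℝ≥0∞) / 2 * μ {ω | F.card ≤ 2 * (F.filter fun i => p i ω).card}) := by
          rw [← mul_assoc, ENNReal.mul_div_cancel (by simp) (by simp)]
      _ ≤ 2 * (F.card * q) := by gcongr
      _ = _ := by ring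
  exact (ENNReal.mul_le_mul_iff_right hc0 (by simp)).1 h5

lemma dist_le_dataDiam (X : Fin n → EuclideanSpace ℝ (Fin D)) {A : Set (EuclideanSpace ℝ (Fin D))}
    {x y : EuclideanSpace ℝ (Fin D)} (hx : x ∈ A ∩ Set.range X) (hy : y ∈ A ∩ Set.range X) :
    dist x y ≤ dataDiam X A :=
  Metric.dist_le_diam_of_mem ((Set.finite_range X).inter_of_right A).isBounded hx hy

/-- With high probability the projected median of the sample points in `A` is within
`6 Δ_n(A) / √D` of the projection of any given one of them. -/
lemma dirLaw_projMedian_far (X : Fin n → EuclideanSpace ℝ (Fin D))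
    {A : Set (EuclideanSpace ℝ (Fin D))} {x : EuclideanSpace ℝ (Fin D)}
    (hx : x ∈ A ∩ Set.range X) :
    dirLaw D {v | 6 * dataDiam X A / √D < |projMedian X A v - inner ℝ x v|} ≤
      ENNReal.ofReal (4 * Real.exp (-18)) := by
  classical
  set F : Finset (Fin n) := Finset.univ.filter fun i => X i ∈ A with hF
  set R : ℝ := 6 * dataDiam X A / √D with hR
  have hFne : F.Nonempty := by
    obtain ⟨hxA, i, rfl⟩ := hx
    exact ⟨i, by simp [hF, hxA]⟩
  have key := measure_half_le_count (dirLaw D) hFne (fun i v => R < |inner ℝ (X i - x) v|)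
    (fun i => measurableSet_lt measurable_const (by fun_prop))
    (q := ENNReal.ofReal (2 * Real.exp (-18))) (fun i hi => by
      have h := dirLaw_tail (w := X i - x) (ρ := dataDiam X A) (a := 6)
        (by rw [← dist_eq_norm]
            exact dist_le_dataDiam X ⟨by simpa [hF] using hi, i, rfl⟩ hx) (by norm_num)
      norm_num at h ⊢
      exact h)
  have h2 : (2 : ℝ≥0∞) * ENNReal.ofReal (2 * Real.exp (-18)) =
      ENNReal.ofReal (4 * Real.exp (-18)) := by
    rw [show (2 : ℝ≥0∞) = ENNReal.ofReal 2 by simp, ← ENNReal.ofReal_mul (by norm_num)]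
    congr 1; ring
  rw [h2] at key
  refine (measure_mono ?_).trans key
  intro v hv
  simp only [Set.mem_ofPred_eq] at hv ⊢
  by_contra hcon
  push Not at hcon
  have hmem : projMedian X A v ∈ Set.Icc (inner ℝ x v - R) (inner ℝ x v + R) := by
    refine median_mem_Icc ?_
    rw [Multiset.card_map, Multiset.countP_map]
    have hsplit := Finset.card_filter_add_card_filter_not (s := F)
      (fun i => R < |inner ℝ (X i - x) v|)
    have hEq : (F.filter fun i => ¬ R < |inner ℝ (X i - x) v|).card =
        (F.val.filter fun i =>
          (inner ℝ (X i) v : ℝ) ∈ Set.Icc (inner ℝ x v - R) (inner ℝ x v + R)).card := by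
      rw [Finset.card_def, Finset.filter_val]
      congr 1
      refine Multiset.filter_congr fun i _ => ?_
      rw [not_lt, inner_sub_left, abs_le, Set.mem_Icc]
      constructor <;> rintro ⟨h1, h2⟩ <;> constructor <;> linarith
    have hc : F.card = Multiset.card F.val := rfl
    rw [← hc, ← hEq]
    omega
  refine absurd hv (not_lt.2 ?_)
  rw [abs_le]
  constructor <;> linarith [hmem.1, hmem.2]

/-- The geometric part of the argument for one direction `v`: if `v` spreads `x` and `x'` apart,
keeps `T` and `T'` close to `x` and `x'`, and the median close to both, then an interval of
noises of length at least `1 / 48` separates `T` from `T'`. -/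
lemma noise_separates {X : Fin n → EuclideanSpace ℝ (Fin D)}
    {A T T' : Set (EuclideanSpace ℝ (Fin D))} {v x x' : EuclideanSpace ℝ (Fin D)} {h : ℝ}
    (hh : h = dataDiam X A / (16 * √D)) (hpos : 0 < h)
    (hT : ∀ z ∈ T, |inner ℝ (z - x) v| ≤ h) (hT' : ∀ z ∈ T', |inner ℝ (z - x') v| ≤ h)
    (hm : |projMedian X A v - inner ℝ x v| ≤ 96 * h)
    (hm' : |projMedian X A v - inner ℝ x' v| ≤ 96 * h)
    (hsep : inner ℝ x v + 4 * h ≤ inner ℝ x' v) :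
    ENNReal.ofReal (1 / 96) ≤ ProbabilityTheory.cond volume (Set.Icc (-1 : ℝ) 1)
      {u | (∀ z ∈ T, inner ℝ z v ≤ noisyThreshold X A (v, u)) ∧
        ∀ z ∈ T', noisyThreshold X A (v, u) < inner ℝ z v} := by
  set p : ℝ := inner ℝ x v
  set q : ℝ := inner ℝ x' v
  set med := projMedian X A v with hmed
  rw [abs_le] at hm hm'
  have hthr : ∀ u, noisyThreshold X A (v, u) = med + u * (96 * h) := by
    intro u
    rw [noisyThreshold, hh]
    ring
  refine (uniform_Ioo (a := (p + h - med) / (96 * h)) (b := (q - h - med) / (96 * h))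
    ?_ ?_ ?_).trans (measure_mono ?_)
  · rw [le_div_iff₀ (by positivity)]; linarith
  · rw [div_le_iff₀ (by positivity)]; linarith
  · rw [← sub_div, le_div_iff₀ (by positivity)]; linarith
  · rintro u ⟨hu1, hu2⟩
    rw [div_lt_iff₀ (by positivity)] at hu1
    rw [lt_div_iff₀ (by positivity)] at hu2
    refine ⟨fun z hz => ?_, fun z hz => ?_⟩
    · have := (abs_le.1 (hT z hz)).2
      rw [inner_sub_left] at this
      rw [hthr]; linarith
    · have := (abs_le.1 (hT' z hz)).1
      rw [inner_sub_left] at this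
      rw [hthr]; linarith

/-- A single noisy round separates two small pieces at distance comparable to the data diameter
with probability bounded below by an absolute constant. -/
lemma roundLaw_separatingDraws {X : Fin n → EuclideanSpace ℝ (Fin D)}
    {A T T' : Set (EuclideanSpace ℝ (Fin D))} {N b ρ : ℝ}
    (hS : HasHalvingNumber (A ∩ Set.range X) N) (hb : 64 ≤ b) (hN : 4 * N ≤ Real.exp (b / 2))
    (hρ : 0 < ρ) (hbρ : (b + 4) * ρ ≤ dataDiam X A / 16)
    (hTS : T ⊆ A ∩ Set.range X) (hTS' : T' ⊆ A ∩ Set.range X)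
    (hT : ∀ x ∈ T, ∀ y ∈ T, dist x y ≤ ρ) (hT' : ∀ x ∈ T', ∀ y ∈ T', dist x y ≤ ρ)
    {x x' : EuclideanSpace ℝ (Fin D)} (hx : x ∈ T) (hx' : x' ∈ T')
    (hxx' : dataDiam X A / 2 < dist x x') :
    ENNReal.ofReal (1 / 240) ≤ roundLaw D (separatingDraws X A T T') := by
  have hfin : (A ∩ Set.range X).Finite := (Set.finite_range X).inter_of_right A
  have hΔ : 0 < dataDiam X A := by
    have : 0 < (b + 4) * ρ := mul_pos (by linarith) hρ
    linarith
  have hne : x - x' ≠ 0 := by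
    intro h0
    rw [dist_eq_norm, h0, norm_zero] at hxx'
    linarith
  have hD : 0 < √(D : ℝ) := by
    rw [Real.sqrt_pos]
    rcases Nat.eq_zero_or_pos D with rfl | h
    · exact absurd (Subsingleton.elim _ _) hne
    · exact_mod_cast h
  set h : ℝ := dataDiam X A / (16 * √D) with hh
  have hpos : 0 < h := by positivity
  have hflh : (b + 4) * ρ / √D ≤ h := by
    rw [hh, ← div_div]; gcongr
  have h96 : 6 * dataDiam X A / √D = 96 * h := by rw [hh]; ring
  have hms := measurableSet_separatingDraws X A (hfin.subset hTS).countable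
    (hfin.subset hTS').countable
  -- the directions excluded from consideration
  set B1 : Set (EuclideanSpace ℝ (Fin D)) :=
    {v | |inner ℝ (x - x') v| ≤ ‖x - x'‖ / (2 * √D)}
  set B2 : Set (EuclideanSpace ℝ (Fin D)) :=
    {v | ∃ z ∈ T, (b + 4) * ρ / √D < |inner ℝ (z - x) v|}
  set B3 : Set (EuclideanSpace ℝ (Fin D)) :=
    {v | ∃ z ∈ T', (b + 4) * ρ / √D < |inner ℝ (z - x') v|}
  set B4 : Set (EuclideanSpace ℝ (Fin D)) :=
    {v | 6 * dataDiam X A / √D < |projMedian X A v - inner ℝ x v|}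
  set B5 : Set (EuclideanSpace ℝ (Fin D)) :=
    {v | 6 * dataDiam X A / √D < |projMedian X A v - inner ℝ x' v|}
  have hbad : dirLaw D (B1 ∪ (B2 ∪ (B3 ∪ (B4 ∪ B5)))) ≤ ENNReal.ofReal (3 / 5) := by
    have e4 : Real.exp (-4) ≤ 1 / 50 := by
      rw [Real.exp_neg, inv_eq_one_div]
      refine one_div_le_one_div_of_le (by norm_num) ?_
      have h1 := Real.exp_one_gt_d9
      calc (50 : ℝ) ≤ 2.7182818283 ^ 4 := by norm_num
        _ ≤ Real.exp 1 ^ 4 := by gcongr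
        _ = Real.exp 4 := by rw [← Real.exp_nat_mul]; norm_num
    have e18 : Real.exp (-18) ≤ 1 / 50 := (Real.exp_le_exp.2 (by norm_num)).trans e4
    have b1 : dirLaw D B1 ≤ ENNReal.ofReal (2 / 5) := dirLaw_anticoncentration hne
    have b2 : dirLaw D B2 ≤ ENNReal.ofReal (1 / 50) :=
      (dirLaw_fluctuation_of_finite hfin hS hb hN hTS hρ hT hx (b + 4)).trans
        (ENNReal.ofReal_le_ofReal (by rwa [show b - (b + 4) = -4 by ring]))
    have b3 : dirLaw D B3 ≤ ENNReal.ofReal (1 / 50) :=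
      (dirLaw_fluctuation_of_finite hfin hS hb hN hTS' hρ hT' hx' (b + 4)).trans
        (ENNReal.ofReal_le_ofReal (by rwa [show b - (b + 4) = -4 by ring]))
    have b4 : dirLaw D B4 ≤ ENNReal.ofReal (4 / 50) :=
      (dirLaw_projMedian_far X (hTS hx)).trans (ENNReal.ofReal_le_ofReal (by linarith))
    have b5 : dirLaw D B5 ≤ ENNReal.ofReal (4 / 50) :=
      (dirLaw_projMedian_far X (hTS' hx')).trans (ENNReal.ofReal_le_ofReal (by linarith))
    calc dirLaw D (B1 ∪ (B2 ∪ (B3 ∪ (B4 ∪ B5))))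
        ≤ ENNReal.ofReal (2 / 5) + (ENNReal.ofReal (1 / 50) + (ENNReal.ofReal (1 / 50) +
            (ENNReal.ofReal (4 / 50) + ENNReal.ofReal (4 / 50)))) := by
          refine (measure_union_le _ _).trans (add_le_add b1 ?_)
          refine (measure_union_le _ _).trans (add_le_add b2 ?_)
          refine (measure_union_le _ _).trans (add_le_add b3 ?_)
          exact (measure_union_le _ _).trans (add_le_add b4 b5)
      _ = ENNReal.ofReal (3 / 5) := by
          rw [← ENNReal.ofReal_add (by norm_num) (by norm_num),
            ← ENNReal.ofReal_add (by norm_num) (by norm_num),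
            ← ENNReal.ofReal_add (by norm_num) (by norm_num),
            ← ENNReal.ofReal_add (by norm_num) (by norm_num)]
          norm_num
  set G : Set (EuclideanSpace ℝ (Fin D)) := {v | ENNReal.ofReal (1 / 96) ≤
    ProbabilityTheory.cond volume (Set.Icc (-1 : ℝ) 1) (Prod.mk v ⁻¹' separatingDraws X A T T')}
    with hG
  have hcover : Set.univ ⊆ G ∪ (B1 ∪ (B2 ∪ (B3 ∪ (B4 ∪ B5)))) := by
    intro v _
    by_contra hcon
    simp only [Set.mem_union, not_or] at hcon
    obtain ⟨hvG, hv1, hv2, hv3, hv4, hv5⟩ := hcon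
    simp only [B1, B2, B3, B4, B5, Set.mem_ofPred_eq, not_le, not_lt, not_exists, not_and]
      at hv1 hv2 hv3 hv4 hv5
    apply hvG
    rw [h96] at hv4 hv5
    have hspread : 4 * h ≤ |inner ℝ (x - x') v| := by
      refine le_trans ?_ hv1.le
      rw [← dist_eq_norm, hh]
      rw [show 4 * (dataDiam X A / (16 * √D)) = dataDiam X A / 2 / (2 * √D) by ring]
      gcongr
    rw [inner_sub_left] at hspread
    rcases le_abs.1 hspread with hs | hs
    · refine (noise_separates hh hpos (fun z hz => (hv3 z hz).trans hflh)
        (fun z hz => (hv2 z hz).trans hflh) hv5 hv4 (by linarith)).trans (measure_mono ?_)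
      exact fun u hu => Or.inr hu
    · refine (noise_separates hh hpos (fun z hz => (hv2 z hz).trans hflh)
        (fun z hz => (hv3 z hz).trans hflh) hv4 hv5 (by linarith)).trans (measure_mono ?_)
      exact fun u hu => Or.inl hu
  have hGm : ENNReal.ofReal (2 / 5) ≤ dirLaw D G := by
    have h1 : (1 : ℝ≥0∞) ≤ dirLaw D G + ENNReal.ofReal (3 / 5) := by
      calc (1 : ℝ≥0∞) = dirLaw D Set.univ := measure_univ.symm
        _ ≤ _ := measure_mono hcover
        _ ≤ _ := measure_union_le _ _
        _ ≤ _ := by gcongr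
    have h2 : ENNReal.ofReal (2 / 5) + ENNReal.ofReal (3 / 5) = 1 := by
      rw [← ENNReal.ofReal_add (by norm_num) (by norm_num)]; norm_num
    rw [← h2] at h1
    exact (ENNReal.add_le_add_iff_right ENNReal.ofReal_ne_top).1 h1
  calc ENNReal.ofReal (1 / 240) = ENNReal.ofReal (1 / 96) * ENNReal.ofReal (2 / 5) := by
        rw [← ENNReal.ofReal_mul (by norm_num)]; norm_num
    _ ≤ ENNReal.ofReal (1 / 96) * dirLaw D G := by gcongr
    _ ≤ ∫⁻ v, ProbabilityTheory.cond volume (Set.Icc (-1 : ℝ) 1)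
          (Prod.mk v ⁻¹' separatingDraws X A T T') ∂(dirLaw D) :=
        mul_meas_ge_le_lintegral (measurable_measure_prodMk_left hms) _
    _ = roundLaw D (separatingDraws X A T T') := (Measure.prod_apply hms).symm

/-! ### The leaves of the tree -/

lemma Tree.mem_leaves_splitLeaves {v : EuclideanSpace ℝ (Fin D)}
    {t : Set (EuclideanSpace ℝ (Fin D)) → ℝ} {C : Set (EuclideanSpace ℝ (Fin D))} {T : Tree D}
    (hC : C ∈ (T.splitLeaves v t).leaves) :
    ∃ B ∈ T.leaves, C = {x ∈ B | inner ℝ x v ≤ t B} ∨ C = B \ {x ∈ B | inner ℝ x v ≤ t B} := by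
  induction T with
  | leaf A => simpa [Tree.splitLeaves, Tree.leaves] using hC
  | node A L R ihL ihR =>
    simp only [Tree.splitLeaves, Tree.leaves, List.mem_append] at hC ⊢
    rcases hC with hC | hC
    · obtain ⟨B, hB, h⟩ := ihL hC
      exact ⟨B, Or.inl hB, h⟩
    · obtain ⟨B, hB, h⟩ := ihR hC
      exact ⟨B, Or.inr hB, h⟩

lemma Tree.depth_splitLeaves (v : EuclideanSpace ℝ (Fin D))
    (t : Set (EuclideanSpace ℝ (Fin D)) → ℝ) (T : Tree D) :
    (T.splitLeaves v t).depth = T.depth + 1 := by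
  induction T with
  | leaf A => rfl
  | node A L R ihL ihR => simp [Tree.splitLeaves, Tree.depth, ihL, ihR]

lemma depth_grow (X : Fin n → EuclideanSpace ℝ (Fin D)) (A : Set (EuclideanSpace ℝ (Fin D)))
    (l : ℕ) (ω : ℕ → EuclideanSpace ℝ (Fin D) × ℝ) (i : ℕ) : (grow X A l ω i).depth = i := by
  induction i with
  | zero => rfl
  | succ i ih => rw [grow, Tree.depth_splitLeaves, ih]

lemma subset_of_mem_leaves_grow {X : Fin n → EuclideanSpace ℝ (Fin D)}
    {A : Set (EuclideanSpace ℝ (Fin D))} {l : ℕ} {ω : ℕ → EuclideanSpace ℝ (Fin D) × ℝ} {i : ℕ}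
    {C : Set (EuclideanSpace ℝ (Fin D))} (hC : C ∈ (grow X A l ω i).leaves) : C ⊆ A := by
  induction i generalizing C with
  | zero => simp [grow, Tree.leaves] at hC; exact hC.subset
  | succ i ih =>
    obtain ⟨B, hB, rfl | rfl⟩ := Tree.mem_leaves_splitLeaves hC
    · exact fun x hx => ih hB hx.1
    · exact fun x hx => ih hB hx.1

/-- Each cell lies on one side of the hyperplane of every earlier noisy round. -/
lemma leaf_one_side {X : Fin n → EuclideanSpace ℝ (Fin D)}
    {A : Set (EuclideanSpace ℝ (Fin D))} {l : ℕ} {ω : ℕ → EuclideanSpace ℝ (Fin D) × ℝ} {i m : ℕ}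
    {C : Set (EuclideanSpace ℝ (Fin D))} (hC : C ∈ (grow X A l ω i).leaves) (hm : m < i)
    (hodd : Odd (l + (m + 1))) :
    (∀ x ∈ C, inner ℝ x (ω m).1 ≤ noisyThreshold X A (ω m)) ∨
      ∀ x ∈ C, noisyThreshold X A (ω m) < inner ℝ x (ω m).1 := by
  induction i generalizing C with
  | zero => omega
  | succ i ih =>
    obtain ⟨B, hB, hCB⟩ := Tree.mem_leaves_splitLeaves hC
    rcases (Nat.lt_succ_iff.1 hm).eq_or_lt with rfl | hlt
    · have ht : threshold X A l (m + 1) (ω m).1 (ω m).2 B = noisyThreshold X A (ω m) := by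
        rw [threshold, if_pos hodd]; rfl
      rw [ht] at hCB
      rcases hCB with rfl | rfl
      · exact Or.inl fun x hx => hx.2
      · refine Or.inr fun x hx => ?_
        by_contra hcon
        exact hx.2 ⟨hx.1, not_lt.1 hcon⟩
    · have hCB' : C ⊆ B := by
        rcases hCB with rfl | rfl
        · exact fun x hx => hx.1
        · exact fun x hx => hx.1
      exact (ih hB hlt).imp (fun h x hx => h x (hCB' hx)) fun h x hx => h x (hCB' hx)

lemma not_mem_separatingDraws {X : Fin n → EuclideanSpace ℝ (Fin D)}
    {A T T' : Set (EuclideanSpace ℝ (Fin D))} {l : ℕ} {ω : ℕ → EuclideanSpace ℝ (Fin D) × ℝ}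
    {i m : ℕ} {C : Set (EuclideanSpace ℝ (Fin D))} (hC : C ∈ (grow X A l ω i).leaves) (hm : m < i)
    (hodd : Odd (l + (m + 1))) {x x' : EuclideanSpace ℝ (Fin D)} (hx : x ∈ T) (hx' : x' ∈ T')
    (hxC : x ∈ C) (hxC' : x' ∈ C) : ω m ∉ separatingDraws X A T T' := by
  rintro (⟨h1, h2⟩ | ⟨h1, h2⟩) <;> rcases leaf_one_side hC hm hodd with h | h
  · exact absurd (h2 x' hx') (not_lt.2 (h x' hxC'))
  · exact absurd (h x hxC) (not_lt.2 (h1 x hx))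
  · exact absurd (h2 x hx) (not_lt.2 (h x hxC))
  · exact absurd (h x' hxC') (not_lt.2 (h1 x' hx'))

lemma avgDataDiam_le {X : Fin n → EuclideanSpace ℝ (Fin D)}
    {P : List (Set (EuclideanSpace ℝ (Fin D)))} {δ : ℝ} (hδ : 0 ≤ δ)
    (h : ∀ C ∈ P, dataDiam X C ≤ δ) : avgDataDiam X P ≤ δ := by
  have hmass : ∀ C, 0 ≤ empMass X C := fun C => by unfold empMass; positivity
  refine Real.sqrt_le_iff.2 ⟨hδ, ?_⟩
  refine div_le_of_le_mul₀ (List.sum_nonneg ?_) (by positivity) ?_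
  · intro a ha
    obtain ⟨C, -, rfl⟩ := List.mem_map.1 ha
    exact hmass C
  · rw [← List.sum_map_mul_left]
    refine List.sum_le_sum fun C hC => ?_
    rw [mul_comm]
    have : 0 ≤ dataDiam X C := Metric.diam_nonneg
    have h1 := h C hC
    have h2 := hmass C
    gcongr

lemma basicRPtree_of_avgDataDiam_le {X : Fin n → EuclideanSpace ℝ (Fin D)}
    {A : Set (EuclideanSpace ℝ (Fin D))} {Δ : ℝ} {l : ℕ}
    {ω : ℕ → EuclideanSpace ℝ (Fin D) × ℝ} {i : ℕ}
    (h : avgDataDiam X (grow X A l ω i).leaves ≤ Δ) :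
    ∃ T : Tree D, basicRPtree X A Δ l ω = some T ∧ T.depth ≤ i := by
  classical
  have hex : ∃ i, avgDataDiam X (grow X A l ω i).leaves ≤ Δ := ⟨i, h⟩
  refine ⟨_, dif_pos hex, ?_⟩
  rw [depth_grow]
  exact Nat.find_min' hex h

/-! ### Many noisy rounds -/

instance isProbabilityMeasure_drawLaw : IsProbabilityMeasure (drawLaw D) := by
  unfold drawLaw; infer_instance

lemma drawLaw_forall_notMem {E : Set (EuclideanSpace ℝ (Fin D) × ℝ)} (hE : MeasurableSet E) {c : ℝ}
    (hc0 : 0 ≤ c) (hc : ENNReal.ofReal c ≤ roundLaw D E) (s : Finset ℕ) :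
    drawLaw D {ω | ∀ m ∈ s, ω m ∉ E} ≤ ENNReal.ofReal (Real.exp (-(c * s.card))) := by
  have h1 : {ω : ℕ → EuclideanSpace ℝ (Fin D) × ℝ | ∀ m ∈ s, ω m ∉ E} =
      Set.pi (s : Set ℕ) fun _ => Eᶜ := by
    ext ω; simp [Set.mem_pi]
  have h2 : roundLaw D Eᶜ ≤ ENNReal.ofReal (Real.exp (-c)) := by
    rw [prob_compl_eq_one_sub hE]
    calc 1 - roundLaw D E ≤ 1 - ENNReal.ofReal c := tsub_le_tsub_left hc _
      _ = ENNReal.ofReal (1 - c) := by rw [ENNReal.ofReal_sub _ hc0, ENNReal.ofReal_one]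
      _ ≤ _ := ENNReal.ofReal_le_ofReal (Real.one_sub_le_exp_neg c)
  rw [h1, drawLaw, Measure.infinitePi_pi _ fun _ _ => hE.compl, Finset.prod_const]
  calc (roundLaw D Eᶜ) ^ s.card ≤ ENNReal.ofReal (Real.exp (-c)) ^ s.card := by gcongr
    _ = ENNReal.ofReal (Real.exp (-(c * s.card))) := by
        rw [← ENNReal.ofReal_pow (Real.exp_pos _).le, ← Real.exp_nat_mul]
        congr 2; ring

/-- The rounds of `0, …, 2 k - 1` (counted from `0`) that are noisy. -/
def noisyRounds (l k : ℕ) : Finset ℕ :=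
  (Finset.range k).image fun j => 2 * j + l % 2

lemma card_noisyRounds (l k : ℕ) : (noisyRounds l k).card = k := by
  rw [noisyRounds, Finset.card_image_of_injective _ fun a b h => by simpa using h,
    Finset.card_range]

lemma mem_noisyRounds {l k m : ℕ} (hm : m ∈ noisyRounds l k) :
    m < 2 * k ∧ Odd (l + (m + 1)) := by
  obtain ⟨j, hj, rfl⟩ := Finset.mem_image.1 hm
  rw [Finset.mem_range] at hj
  refine ⟨by omega, ?_⟩
  rw [Nat.odd_iff]
  omega

/-- Union bound over all pairs of pieces of diameter at most `Δ_n(A) / 2 ^ K`: after `2 k` rounds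
every cell has data diameter at most `Δ_n(A) / 2`, up to probability `N ^ (2 K) exp (-k / 240)`. -/
lemma drawLaw_exists_large_leaf {X : Fin n → EuclideanSpace ℝ (Fin D)}
    {A : Set (EuclideanSpace ℝ (Fin D))} {N b : ℝ} (hN0 : 0 ≤ N)
    (hS : HasHalvingNumber (A ∩ Set.range X) N) (hb : 64 ≤ b) (hN : 4 * N ≤ Real.exp (b / 2))
    {K : ℕ} (hK : 16 * (b + 4) ≤ 2 ^ K) (hΔ : 0 < dataDiam X A) (l k : ℕ) :
    drawLaw D {ω | ∃ C ∈ (grow X A l ω (2 * k)).leaves, dataDiam X A / 2 < dataDiam X C} ≤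
      ENNReal.ofReal (N ^ K * N ^ K * Real.exp (-(1 / 240 * k))) := by
  classical
  have hfin : (A ∩ Set.range X).Finite := (Set.finite_range X).inter_of_right A
  obtain ⟨P, hPN, hSP, hP⟩ := hS.iterate hN0 subset_rfl hΔ
    (fun x hx y hy => dist_le_dataDiam X hx hy) K
  set far : Finset (Set (EuclideanSpace ℝ (Fin D)) × Set (EuclideanSpace ℝ (Fin D))) :=
    (P ×ˢ P).filter fun q => ∃ x ∈ q.1, ∃ x' ∈ q.2, dataDiam X A / 2 < dist x x' with hfar
  have hsub : {ω | ∃ C ∈ (grow X A l ω (2 * k)).leaves, dataDiam X A / 2 < dataDiam X C} ⊆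
      ⋃ q ∈ far, {ω | ∀ m ∈ noisyRounds l k, ω m ∉ separatingDraws X A q.1 q.2} := by
    rintro ω ⟨C, hC, hCd⟩
    obtain ⟨x, hx, x', hx', hxx'⟩ : ∃ x ∈ C ∩ Set.range X, ∃ x' ∈ C ∩ Set.range X,
        dataDiam X A / 2 < dist x x' := by
      by_contra hcon
      push Not at hcon
      exact absurd hCd (not_lt.2 (Metric.diam_le_of_forall_dist_le (by positivity) hcon))
    have hCA := subset_of_mem_leaves_grow hC
    have hU := hSP ⟨hCA hx.1, hx.2⟩
    have hV := hSP ⟨hCA hx'.1, hx'.2⟩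
    simp only [Set.mem_iUnion] at hU hV ⊢
    obtain ⟨U, hU, hxU⟩ := hU
    obtain ⟨V, hV, hxV⟩ := hV
    refine ⟨(U, V), ?_, fun m hm => ?_⟩
    · exact Finset.mem_filter.2 ⟨Finset.mk_mem_product hU hV, x, hxU, x', hxV, hxx'⟩
    · obtain ⟨hm1, hm2⟩ := mem_noisyRounds hm
      exact not_mem_separatingDraws hC hm1 hm2 hxU hxV hx.1 hx'.1
  have hpair : ∀ q ∈ far,
      drawLaw D {ω | ∀ m ∈ noisyRounds l k, ω m ∉ separatingDraws X A q.1 q.2} ≤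
        ENNReal.ofReal (Real.exp (-(1 / 240 * k))) := by
    intro q hq
    obtain ⟨hq1, x, hx, x', hx', hxx'⟩ := Finset.mem_filter.1 hq
    obtain ⟨hU, hV⟩ := Finset.mem_product.1 hq1
    have hbρ : (b + 4) * (dataDiam X A / 2 ^ K) ≤ dataDiam X A / 16 := by
      rw [← mul_div_assoc, div_le_div_iff₀ (by positivity) (by norm_num)]
      nlinarith
    have h := drawLaw_forall_notMem
      (measurableSet_separatingDraws X A (hfin.subset (hP _ hU).1).countable
        (hfin.subset (hP _ hV).1).countable) (by norm_num)
      (roundLaw_separatingDraws hS hb hN (ρ := dataDiam X A / 2 ^ K) (by positivity) hbρ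
        (hP _ hU).1 (hP _ hV).1 (hP _ hU).2 (hP _ hV).2 hx hx' hxx') (noisyRounds l k)
    rwa [card_noisyRounds] at h
  have hcard : (far.card : ℝ) ≤ N ^ K * N ^ K := by
    calc (far.card : ℝ) ≤ ((P ×ˢ P).card : ℕ) := by exact_mod_cast Finset.card_filter_le _ _
      _ = P.card * P.card := by rw [Finset.card_product]; push_cast; rfl
      _ ≤ _ := by gcongr
  calc _ ≤ _ := measure_mono hsub
    _ ≤ ∑ q ∈ far, _ := measure_biUnion_finset_le _ _
    _ ≤ ∑ _q ∈ far, ENNReal.ofReal (Real.exp (-(1 / 240 * k))) := Finset.sum_le_sum hpair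
    _ = ENNReal.ofReal (far.card * Real.exp (-(1 / 240 * k))) := by
        rw [Finset.sum_const, nsmul_eq_mul, ENNReal.ofReal_mul (by positivity)]
        simp
    _ ≤ _ := ENNReal.ofReal_le_ofReal (by gcongr)

/-- The numerical choices: a number `K` of scales of order `log d` and a number `k` of noisy rounds
of order `d * K` that make the union bound at most `1 / 2`. -/
lemma exists_scales_rounds {d : ℝ} (hd : 1 ≤ d) :
    ∃ K k : ℕ, 16 * (64 * d + 4) ≤ 2 ^ K ∧
      ((2 : ℝ) ^ d * (2 : ℝ) ^ d) ^ K * ((2 : ℝ) ^ d * (2 : ℝ) ^ d) ^ K *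
        Real.exp (-(1 / 240 * k)) ≤ 1 / 2 ∧
      ((2 * k : ℕ) : ℝ) ≤ 60000 * d * Real.log (max d 2) := by
  have hl1 := Real.log_two_gt_d9
  have hl2 := Real.log_two_lt_d9
  set L : ℝ := Real.log (max d 2) with hL
  have hL2 : Real.log 2 ≤ L := Real.log_le_log (by norm_num) (le_max_right _ _)
  have hLd : Real.log d ≤ L := Real.log_le_log (by linarith) (le_max_left _ _)
  set K : ℕ := ⌈Real.log (1088 * d) / Real.log 2⌉₊ with hK
  set k : ℕ := ⌈240 * (4 * d * K + 1)⌉₊ with hk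
  have hlog : Real.log (1088 * d) ≤ 12 * L := by
    rw [Real.log_mul (by norm_num) (by linarith)]
    have : Real.log 1088 ≤ 11 * Real.log 2 := by
      rw [show (11 : ℝ) * Real.log 2 = Real.log (2 ^ 11) by rw [Real.log_pow]; norm_num]
      exact Real.log_le_log (by norm_num) (by norm_num)
    linarith
  have hK1 : Real.log (1088 * d) / Real.log 2 ≤ K := Nat.le_ceil _
  have hK2 : (K : ℝ) ≤ 26 * L := by
    have h0 : 0 ≤ Real.log (1088 * d) / Real.log 2 :=
      div_nonneg (Real.log_nonneg (by linarith)) (by linarith)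
    have h1 := (Nat.ceil_lt_add_one h0).le
    have h2 : Real.log (1088 * d) / Real.log 2 ≤ 24 * L := by
      rw [div_le_iff₀ (by linarith)]
      nlinarith
    linarith
  have hk1 : 240 * (4 * d * K + 1) ≤ (k : ℝ) := Nat.le_ceil _
  have hk2 : (k : ℝ) ≤ 240 * (4 * d * K + 1) + 1 := (Nat.ceil_lt_add_one (by positivity)).le
  refine ⟨K, k, ?_, ?_, ?_⟩
  · have : 1088 * d ≤ 2 ^ K := by
      rw [div_le_iff₀ (by linarith), ← Real.log_pow] at hK1
      exact (Real.log_le_log_iff (by linarith) (by positivity)).1 hK1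
    linarith
  · have h2 : (2 : ℝ) ^ d = Real.exp (Real.log 2 * d) := Real.rpow_def_of_pos (by norm_num) d
    rw [h2, ← Real.exp_add, ← Real.exp_nat_mul, ← Real.exp_add, ← Real.exp_add]
    have h3 : (1 : ℝ) / 2 = Real.exp (-Real.log 2) := by
      rw [Real.exp_neg, Real.exp_log (by norm_num)]; norm_num
    rw [h3]
    apply Real.exp_le_exp.2
    have h4 : 0 ≤ d * K := by positivity
    nlinarith
  · push_cast
    have h5 : d * K ≤ d * (26 * L) := by gcongr
    have h6 : 1 ≤ 2 * (d * L) := by nlinarith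
    nlinarith

end RPTree

theorem mainTheorem4 :
    ∃ C' : ℝ, 0 < C' ∧
      ∀ (D n : ℕ) (X : Fin n → EuclideanSpace ℝ (Fin D)) (A : Set (EuclideanSpace ℝ (Fin D)))
        (l : ℕ) (d : ℝ), RPTree.HasAssouadDim (A ∩ Set.range X) d →
        (1 / 2 : ℝ≥0∞) ≤ RPTree.drawLaw D
          {ω | ∃ T : RPTree.Tree D,
            RPTree.basicRPtree X A (RPTree.dataDiam X A / 2) l ω = some T ∧
              (T.depth : ℝ) ≤ C' * d * Real.log (max d 2)} := by
  refine ⟨60000, by norm_num, fun D n X A l d hd => ?_⟩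
  have hd0 : 0 ≤ d := hd.1.1
  have hfin : (A ∩ Set.range X).Finite := (Set.finite_range X).inter_of_right A
  have hΔ0 : 0 ≤ RPTree.dataDiam X A := Metric.diam_nonneg
  rcases hΔ0.eq_or_lt with hΔ | hΔ
  · -- The root cell already has data diameter `0`, so the procedure stops at once.
    have hall : ∀ ω, ∃ T : RPTree.Tree D,
        RPTree.basicRPtree X A (RPTree.dataDiam X A / 2) l ω = some T ∧
          (T.depth : ℝ) ≤ 60000 * d * Real.log (max d 2) := by
      intro ω
      obtain ⟨T, hT, hTd⟩ := RPTree.basicRPtree_of_avgDataDiam_le (X := X) (A := A)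
        (Δ := RPTree.dataDiam X A / 2) (l := l) (ω := ω) (i := 0)
        (RPTree.avgDataDiam_le (by positivity) (by simp [RPTree.grow, RPTree.Tree.leaves, ← hΔ]))
      have hlog : 0 ≤ Real.log (max d 2) :=
        Real.log_nonneg (le_trans (by norm_num) (le_max_right d 2))
      refine ⟨T, hT, ?_⟩
      rw [Nat.le_zero.1 hTd]
      push_cast
      positivity
    have huniv := Set.eq_univ_of_forall (s := {ω | ∃ T : RPTree.Tree D,
        RPTree.basicRPtree X A (RPTree.dataDiam X A / 2) l ω = some T ∧
          (T.depth : ℝ) ≤ 60000 * d * Real.log (max d 2)}) hall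
    rw [huniv, measure_univ]
    simp
  have hd1 : 1 ≤ d := by
    by_contra hlt
    have := Metric.diam_subsingleton (hd.subsingleton_of_lt_one (not_le.1 hlt) hfin.isBounded)
    exact hΔ.ne' this
  obtain ⟨K, k, hK, hprob, hdepth⟩ := RPTree.exists_scales_rounds hd1
  have hN : 4 * ((2 : ℝ) ^ d * (2 : ℝ) ^ d) ≤ Real.exp (64 * d / 2) := by
    have h4 : (4 : ℝ) = Real.exp (Real.log 2 * 2) := by
      rw [← Real.rpow_def_of_pos (by norm_num)]; norm_num
    rw [Real.rpow_def_of_pos (by norm_num), h4, ← Real.exp_add, ← Real.exp_add]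
    apply Real.exp_le_exp.2
    nlinarith [Real.log_two_lt_d9]
  have hbad := (RPTree.drawLaw_exists_large_leaf (by positivity) hd.hasHalvingNumber
    (by linarith) hN hK hΔ l k).trans (ENNReal.ofReal_le_ofReal hprob)
  have hcover : (Set.univ : Set (ℕ → EuclideanSpace ℝ (Fin D) × ℝ)) ⊆
      {ω | ∃ T : RPTree.Tree D,
        RPTree.basicRPtree X A (RPTree.dataDiam X A / 2) l ω = some T ∧
          (T.depth : ℝ) ≤ 60000 * d * Real.log (max d 2)} ∪
      {ω | ∃ C ∈ (RPTree.grow X A l ω (2 * k)).leaves,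
        RPTree.dataDiam X A / 2 < RPTree.dataDiam X C} := by
    intro ω _
    by_cases hω : ∃ C ∈ (RPTree.grow X A l ω (2 * k)).leaves,
        RPTree.dataDiam X A / 2 < RPTree.dataDiam X C
    · exact Or.inr hω
    · push Not at hω
      obtain ⟨T, hT, hTd⟩ := RPTree.basicRPtree_of_avgDataDiam_le
        (RPTree.avgDataDiam_le (by positivity) hω)
      exact Or.inl ⟨T, hT, le_trans (by exact_mod_cast hTd) hdepth⟩
  have h1 : (1 : ℝ≥0∞) ≤ RPTree.drawLaw D {ω | ∃ T : RPTree.Tree D,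
        RPTree.basicRPtree X A (RPTree.dataDiam X A / 2) l ω = some T ∧
          (T.depth : ℝ) ≤ 60000 * d * Real.log (max d 2)} + ENNReal.ofReal (1 / 2) := by
    calc (1 : ℝ≥0∞) = RPTree.drawLaw D Set.univ := measure_univ.symm
      _ ≤ _ := measure_mono hcover
      _ ≤ _ := measure_union_le _ _
      _ ≤ _ := by gcongr
  have h2 : ENNReal.ofReal (1 / 2) = 1 / 2 := by
    rw [ENNReal.ofReal_div_of_pos (by norm_num)]; simp
  rw [h2] at h1
  refine (ENNReal.add_le_add_iff_right (a := 1 / 2) (by simp)).1 ?_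
  rwa [ENNReal.add_halves]
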